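/- Let $\mathcal K$ be a commutative (entropic) variety of finitary algebras, that is, one in which every operation $\sigma_K:K^n\to K$ of every algebra $K$ is a homomorphism. For algebras $A,B$ let $[A,B]$ be the algebra of all homomorphisms $A\to B$ with pointwise operations; $\mathcal K$ is enriched over itself by these hom-objects (it is symmetric monoidal closed for the tensor product that represents bimorphisms). Let $D$ be an algebra, write $X^{\ast}=[X,D]$, and let $(-)^{\ast\ast}$ be the double-dualization monad, with unit $\eta_X:X\to X^{\ast\ast}$ given by evaluation. Let $E:\mathcal K_{fp}\hookrightarrow\mathcal K$ be the full embedding of the finitely presentable algebras. Assume that $D$ is a $\ast$-cogenerator: $D$ is a cogenerator of $\mathcal K$ and, for every algebra $X$, the morphisms $a^{\ast}:A^{\ast}\to X^{\ast}$, for all $a:X\to A$ with $A$ finitely presentable, form a colimit cocone of the diagram $(X/\mathcal K_{fp})^{\mathrm{op}}\to\mathcal K$, $(A,a)\mapsto A^{\ast}$. Let $\mathbb T$ be the $D$-ultrafilter monad, that is, the submonad of $(-)^{\ast\ast}$ for which $TX\subseteq X^{\ast\ast}$ is the intersection, over all $a:X\to A$ with $A$ finitely presentable, of the preimages of $\eta_A:A\rightarrowtail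 A^{\ast\ast}$ under $a^{\ast\ast}:X^{\ast\ast}\to A^{\ast\ast}$. Then $\mathbb T$ is the $\mathcal K$-enriched codensity monad of $E$ (the enriched right Kan extension of $E$ along itself with its canonical monad structure). Explicitly: for algebras $X,Z$ let $N(X,Z)$ be the algebra of enriched natural transformations $[X,E-]\to[Z,E-]$, i.e. the equalizer of $$u,v:\prod_{A\in\mathcal K_{fp}}[[X,A],[Z,A]]\rightrightarrows\prod_{B,C\in\mathcal K_{fp}}\big[[B,C],[[X,B],[Z,C]]\big],\qquad u(\tau)_{B,C}(f)=[Z,f]\cdot\tau_B,\quad v(\tau)_{B,C}(f)=\tau_C\cdot[X,f].$$ Then $T$ is an enriched functor, and there are isomorphisms of algebras $$\lambda_{X,Z}:[Z,TX]\cong N(X,Z),$$ natural in $Z$ and in $X$, such that, with $\psi_a=\lambda_{X,TX}(\mathrm{id}_{TX})_A(a):TX\to A$ for $a:X\to A$ with $A$ finitely presentable, the unit $\eta^T$ and the multiplication $\mu^T$ of $\mathbb T$ are those of the codensity monad: $\lambda_{X,X}(\eta^T_X)_A(a)=a$ and $\lambda_{X,TTX}(\mu^T_X)_A(a)=\psi_{\psi_a}$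 (equivalently, $\psi_a\cdot\eta^T_X=a$ and $\psi_a\cdot\mu^T_X=\psi_{\psi_a}$). -/

import Mathlib

open CategoryTheory CategoryTheory.Limits Opposite
open scoped FirstOrder

universe u v v' v'' w w'

noncomputable section

namespace EntropicVariety

/-! ### Varieties of finitary algebras -/

/-- An equational presentation of a variety of finitary algebras: a signature of finitary operation
symbols (a first-order language without relation symbols) and a set of equations between terms. -/
structure Variety where
  /-- the signature; `sig.Functions n` is the set of `n`-ary operation symbols -/
  sig : FirstOrder.Language.{u, u}
  [isAlgebraic : sig.IsAlgebraic]
  /-- the equations (pairs of terms in countably many variables) -/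
  equations : Set (sig.Term ℕ × sig.Term ℕ)

attribute [instance] Variety.isAlgebraic

/-- The structure `M` satisfies all equations of the variety. -/
def Variety.Satisfies (V : Variety.{u}) (M : Type v) [V.sig.Structure M] : Prop :=
  ∀ e ∈ V.equations, ∀ x : ℕ → M, e.1.realize x = e.2.realize x

/-- The algebras of the variety `V`, with carriers in `Type v`. -/
structure Variety.Alg (V : Variety.{u}) where
  /-- the underlying set -/
  carrier : Type v
  [str : V.sig.Structure carrier]
  sat : V.Satisfies carrier

variable {V : Variety.{u}}

instance : CoeSort (Variety.Alg.{u, v} V) (Type v) := ⟨Variety.Alg.carrier⟩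

instance (A : Variety.Alg.{u, v} V) : V.sig.Structure A := A.str

/-- The operation of an algebra given by an operation symbol. -/
abbrev oper (A : Variety.Alg.{u, v} V) {n : ℕ} (σ : V.sig.Functions n) (a : Fin n → A) : A :=
  FirstOrder.Language.Structure.funMap σ a

/-- The category of algebras of `V` and homomorphisms. -/
instance : Category.{v} (Variety.Alg.{u, v} V) where
  Hom A B := A →[V.sig] B
  id A := FirstOrder.Language.Hom.id V.sig A
  comp f g := FirstOrder.Language.Hom.comp g f

instance (A B : Variety.Alg.{u, v} V) : FunLike (A ⟶ B) A B :=
  inferInstanceAs (FunLike (A →[V.sig] B) A B)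

/-- A function that preserves all operations, as a homomorphism. -/
def mkHom {A : Variety.Alg.{u, v} V} {B : Variety.Alg.{u, w} V} (f : A → B)
    (hf : ∀ {n : ℕ} (σ : V.sig.Functions n) (a : Fin n → A),
      f (oper A σ a) = oper B σ (fun i => f (a i))) : A →[V.sig] B where
  toFun := f
  map_fun' σ a := hf σ a
  map_rel' r := isEmptyElim r

@[simp] theorem mkHom_apply {A : Variety.Alg.{u, v} V} {B : Variety.Alg.{u, w} V} (f : A → B)
    (hf) (a : A) : (mkHom f hf : A →[V.sig] B) a = f a := rfl

@[simp] theorem id_apply (A : Variety.Alg.{u, v} V) (a : A) : (𝟙 A : A ⟶ A) a = a := rfl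

@[simp] theorem comp_apply {A B C : Variety.Alg.{u, v} V} (f : A ⟶ B) (g : B ⟶ C) (a : A) :
    (f ≫ g) a = g (f a) := rfl

theorem hom_op {A B : Variety.Alg.{u, v} V} (f : A ⟶ B) {n : ℕ} (σ : V.sig.Functions n)
    (a : Fin n → A) : f (oper A σ a) = oper B σ (fun i => f (a i)) :=
  FirstOrder.Language.Hom.map_fun f σ a

@[ext] theorem hom_ext {A B : Variety.Alg.{u, v} V} {f g : A ⟶ B} (h : ∀ a, f a = g a) : f = g :=
  DFunLike.ext f g h

/-- A structure with a jointly injective family of homomorphisms into algebras of `V` is an algebra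
of `V`. -/
theorem satisfies_of_jointly_injective {M : Type v} [V.sig.Structure M] {ι : Type w}
    (F : ι → Variety.Alg.{u, w'} V) (p : ∀ i, M →[V.sig] F i)
    (hp : ∀ x y : M, (∀ i, p i x = p i y) → x = y) : V.Satisfies M := by
  intro e he x
  refine hp _ _ fun i => ?_
  rw [← FirstOrder.Language.HomClass.realize_term, ← FirstOrder.Language.HomClass.realize_term]
  exact (F i).sat e he _

/-- The product of a family of algebras, with pointwise operations. -/
def pi {ι : Type w} (F : ι → Variety.Alg.{u, v} V) : Variety.Alg.{u, max w v} V :=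
  letI : V.sig.Structure (∀ i, F i) :=
    { funMap := fun σ x i => oper (F i) σ (fun k => x k i) }
  { carrier := ∀ i, F i
    sat := satisfies_of_jointly_injective F
      (fun i =>
        { toFun := fun x => x i
          map_fun' := fun _ _ => rfl
          map_rel' := fun r => isEmptyElim r })
      (fun _ _ h => funext h) }

/-- The projections of a product. -/
def proj {ι : Type w} (F : ι → Variety.Alg.{u, v} V) (i : ι) : pi F →[V.sig] F i :=
  mkHom (fun x => x i) (fun _ _ => rfl)

/-- A subalgebra, as an algebra. -/
def ofSub {A : Variety.Alg.{u, v} V} (S : V.sig.Substructure A) : Variety.Alg.{u, v} V where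
  carrier := S
  sat := satisfies_of_jointly_injective (fun _ : Unit => A) (fun _ => S.subtype.toHom)
    (fun _ _ h => Subtype.ext (h ()))

/-- The inclusion of a subalgebra. -/
def subIncl {A : Variety.Alg.{u, v} V} (S : V.sig.Substructure A) : ofSub S ⟶ A :=
  mkHom (A := ofSub S) (B := A) (fun x => x.1) (fun _ _ => rfl)

/-! ### Commutative varieties, hom-objects and bimorphisms -/

/-- The variety is commutative (entropic): every operation of every algebra `K` is a homomorphism
`K ^ n → K`, where `K ^ n` has the pointwise operations. -/
class Variety.IsCommutative (V : Variety.{u}) : Prop where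
  comm : ∀ (K : Variety.Alg.{u, u} V) {n : ℕ} (σ : V.sig.Functions n) {m : ℕ}
    (ρ : V.sig.Functions m) (x : Fin m → Fin n → K),
    oper K σ (fun i => oper K ρ (fun j => x j i)) = oper K ρ (fun j => oper K σ (x j))

/-- Bimorphisms `A × B → C`: functions which are homomorphisms in each variable separately. These
are the maps which the tensor product `A ⊗ B` represents. -/
structure Bimorphism (A : Variety.Alg.{u, v} V) (B : Variety.Alg.{u, w} V)
    (C : Variety.Alg.{u, w'} V) where
  /-- the underlying function -/
  toFun : A → B → C
  map_left : ∀ {n : ℕ} (σ : V.sig.Functions n) (a : Fin n → A) (b : B),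
    toFun (oper A σ a) b = oper C σ (fun i => toFun (a i) b)
  map_right : ∀ {n : ℕ} (σ : V.sig.Functions n) (a : A) (b : Fin n → B),
    toFun a (oper B σ b) = oper C σ (fun i => toFun a (b i))

namespace Bimorphism

/-- Composition with the symmetry of the tensor product. -/
def flip {A : Variety.Alg.{u, v} V} {B : Variety.Alg.{u, w} V} {C : Variety.Alg.{u, w'} V}
    (β : Bimorphism A B C) : Bimorphism B A C where
  toFun b a := β.toFun a b
  map_left σ b a := β.map_right σ a b
  map_right σ b a := β.map_left σ a b

/-- Precomposition of a bimorphism with the tensor product `f ⊗ g` of two homomorphisms. -/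
def precomp {A : Variety.Alg.{u, v} V} {B : Variety.Alg.{u, w} V} {C : Variety.Alg.{u, w'} V}
    {A' : Variety.Alg.{u, v'} V} {B' : Variety.Alg.{u, v''} V} (β : Bimorphism A B C)
    (f : A' →[V.sig] A) (g : B' →[V.sig] B) : Bimorphism A' B' C where
  toFun a b := β.toFun (f a) (g b)
  map_left σ a b := by
    rw [← β.map_left]; exact congrArg (β.toFun · (g b)) (f.map_fun σ a)
  map_right σ a b := by
    rw [← β.map_right]; exact congrArg (β.toFun (f a)) (g.map_fun σ b)

end Bimorphism

variable [V.IsCommutative]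

/-- The hom-object `[A, B]`: the algebra of all homomorphisms from `A` to `B` with pointwise
operations. With the tensor product representing bimorphisms, these are the hom-objects of the
closed monoidal structure, see `curryEquiv`. -/
def ihom (A B : Variety.Alg.{u, u} V) : Variety.Alg.{u, u} V :=
  letI : V.sig.Structure (A ⟶ B) :=
    { funMap := fun {n} σ f => mkHom (fun a => oper B σ (fun i => f i a)) (by
        intro m ρ a
        rw [← Variety.IsCommutative.comm B σ ρ (fun j i => f i (a j))]
        congr 1
        funext i
        exact hom_op (f i) ρ a) }
  { carrier := A ⟶ B
    sat := satisfies_of_jointly_injective (fun _ : A => B)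
      (fun a =>
        { toFun := fun f => f a
          map_fun' := fun _ _ => rfl
          map_rel' := fun r => isEmptyElim r })
      (fun _ _ h => hom_ext h) }

/-- An element of the hom-object `[A, B]`, as a homomorphism. -/
def toHom {A B : Variety.Alg.{u, u} V} (f : ihom A B) : A ⟶ B := f

/-- A homomorphism, as an element of the hom-object `[A, B]`. -/
def ofHom {A B : Variety.Alg.{u, u} V} (f : A ⟶ B) : ihom A B := f

/-- The transpose `A → [B, C]` of a bimorphism `A × B → C`. -/
def Bimorphism.curry {A : Variety.Alg.{u, v} V} {B C : Variety.Alg.{u, u} V}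
    (β : Bimorphism A B C) : A →[V.sig] ihom B C :=
  mkHom (B := ihom B C)
    (fun a => ofHom (A := B) (B := C) (mkHom (β.toFun a) (fun σ b => β.map_right σ a b)))
    (fun σ a => hom_ext (A := B) (B := C) (fun b => β.map_left σ a b))

/-- The evaluation bimorphism `X × [X, D] → D`. -/
def eval (X D : Variety.Alg.{u, u} V) : Bimorphism X (ihom X D) D where
  toFun x f := toHom f x
  map_left σ x f := hom_op (toHom f) σ x
  map_right _ _ _ := rfl

/-- The closed structure: transposition is a bijection between bimorphisms `A × B → C` (that is,
homomorphisms `A ⊗ B → C`) and homomorphisms `A → [B, C]`. -/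
def curryEquiv (A : Variety.Alg.{u, v} V) (B C : Variety.Alg.{u, u} V) :
    Bimorphism A B C ≃ (A →[V.sig] ihom B C) where
  toFun β := β.curry
  invFun g :=
    { toFun := fun a b => toHom (g a) b
      map_left := fun σ a b =>
        congrArg (fun f : ihom B C => toHom f b) (g.map_fun σ a)
      map_right := fun σ a b => hom_op (toHom (g a)) σ b }
  left_inv _ := rfl
  right_inv _ := rfl

/-- The composition `[A, B] × [B, C] → [A, C]` of the enrichment of the category of algebras
over itself. -/
def comp (A B C : Variety.Alg.{u, u} V) : Bimorphism (ihom A B) (ihom B C) (ihom A C) where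
  toFun f g := ofHom (toHom f ≫ toHom g)
  map_left σ f g := hom_ext (A := A) (B := C) fun a =>
    hom_op (toHom g) σ (fun i => toHom (f i) a)
  map_right _ _ _ := rfl

/-- The action `[B, C] → [[X, B], [X, C]]` on hom-objects of the enriched hom-functor `[X, -]`. -/
def homAct (X B C : Variety.Alg.{u, u} V) : ihom B C ⟶ ihom (ihom X B) (ihom X C) :=
  (comp X B C).flip.curry

/-- The homomorphism `[h, C] : [B, C] → [A, C]` given by precomposition with `h : A ⟶ B`. -/
def precompHom {A B : Variety.Alg.{u, u} V} (h : A ⟶ B) (C : Variety.Alg.{u, u} V) :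
    ihom B C ⟶ ihom A C :=
  toHom ((comp A B C).curry (ofHom h))

/-! ### Double dualization -/

/-- The contravariant functor `(-)* = [-, D]`. -/
def dual (D : Variety.Alg.{u, u} V) : (Variety.Alg.{u, u} V)ᵒᵖ ⥤ Variety.Alg.{u, u} V where
  obj X := ihom X.unop D
  map f := precompHom f.unop D
  map_id _ := rfl
  map_comp _ _ := rfl

/-- The functor `(-)**`. -/
def doubleDualFunctor (D : Variety.Alg.{u, u} V) :
    Variety.Alg.{u, u} V ⥤ Variety.Alg.{u, u} V :=
  (dual D).rightOp ⋙ dual D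

/-- The unit `X → X**` of double dualization: the transpose of the evaluation. -/
def evalUnit (D X : Variety.Alg.{u, u} V) : X ⟶ (doubleDualFunctor D).obj X :=
  (eval X D).curry

/-- The multiplication `X**** → X**` of double dualization: the dual of the unit at `X*`. -/
def evalMul (D X : Variety.Alg.{u, u} V) :
    (doubleDualFunctor D).obj ((doubleDualFunctor D).obj X) ⟶ (doubleDualFunctor D).obj X :=
  precompHom (evalUnit D (ihom X D)) D

/-- The double-dualization monad `(-)**`. -/
def doubleDual (D : Variety.Alg.{u, u} V) : Monad (Variety.Alg.{u, u} V) where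
  toFunctor := doubleDualFunctor D
  η := { app := fun X => evalUnit D X
         naturality := fun _ _ _ => rfl }
  μ := { app := fun X => evalMul D X
         naturality := fun _ _ _ => rfl }
  assoc _ := rfl
  left_unit _ := rfl
  right_unit _ := rfl

/-! ### Finitely presentable algebras and `*`-cogenerators -/

/-- The property of being a finitely presentable object of the category of algebras: the covariant
hom-functor preserves filtered colimits. -/
abbrev fp (V : Variety.{u}) : ObjectProperty (Variety.Alg.{u, u} V) :=
  ObjectProperty.isFinitelyPresentable.{u} (Variety.Alg.{u, u} V)

/-- For an algebra `X`, the diagram of all `A*`, indexed by the opposite of the category of all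
homomorphisms `a : X ⟶ A` with `A` finitely presentable. -/
def dualDiagram (D X : Variety.Alg.{u, u} V) :
    (StructuredArrow X (fp V).ι)ᵒᵖ ⥤ Variety.Alg.{u, u} V :=
  (StructuredArrow.proj X (fp V).ι ⋙ (fp V).ι).op ⋙ dual D

/-- The canonical cocone with the members `a* : A* ⟶ X*`. -/
def dualCocone (D X : Variety.Alg.{u, u} V) : Cocone (dualDiagram D X) where
  pt := ihom X D
  ι :=
    { app := fun a => precompHom a.unop.hom D
      naturality := by
        intro a b f
        have h := StructuredArrow.w f.unop
        exact congrArg (fun k => precompHom k D) h }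

/-- `D` is a `*`-object: every `X*` is the canonical colimit of all `A*` with `A` finitely
presentable. -/
def IsStarObject (D : Variety.Alg.{u, u} V) : Prop :=
  ∀ X : Variety.Alg.{u, u} V, Nonempty (IsColimit (dualCocone D X))

/-- `D` is a `*`-cogenerator: a cogenerator which is a `*`-object. -/
structure IsStarCogenerator (D : Variety.Alg.{u, u} V) : Prop where
  isCogenerator : IsCoseparator D
  isStarObject : IsStarObject D

/-! ### The `D`-ultrafilter monad -/

/-- The derived subobject of `a : X ⟶ A`: the preimage of (the image of) the unit `A → A**` under
`a** : X** → A**`. -/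
def derived (D : Variety.Alg.{u, u} V) {X A : Variety.Alg.{u, u} V} (a : X ⟶ A) :
    V.sig.Substructure ((doubleDualFunctor D).obj X) :=
  (FirstOrder.Language.Hom.range (evalUnit D A)).comap ((doubleDualFunctor D).map a)

/-- The intersection of the derived subobjects of all `a : X ⟶ A` with `A` finitely presentable.
Its elements are the `D`-ultrafilters on `X`. -/
def ultrafilters (D X : Variety.Alg.{u, u} V) :
    V.sig.Substructure ((doubleDualFunctor D).obj X) :=
  ⨅ a : StructuredArrow X (fp V).ι, derived D a.hom

theorem mem_ultrafilters {D X : Variety.Alg.{u, u} V} {x : (doubleDualFunctor D).obj X} :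
    x ∈ ultrafilters D X ↔ ∀ (A : Variety.Alg.{u, u} V), fp V A → ∀ a : X ⟶ A,
      ∃ t : A, evalUnit D A t = (doubleDualFunctor D).map a x := by
  unfold ultrafilters
  rw [FirstOrder.Language.Substructure.mem_iInf]
  constructor
  · intro h A hA a
    obtain ⟨t, ht⟩ := h (StructuredArrow.mk (Y := (⟨A, hA⟩ : (fp V).FullSubcategory)) a)
    exact ⟨t, ht⟩
  · intro h a
    obtain ⟨t, ht⟩ := h a.right.obj a.right.property a.hom
    exact ⟨t, ht⟩

/-- The algebra `TX` of all `D`-ultrafilters on `X`. -/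
def ultrafilterObj (D X : Variety.Alg.{u, u} V) : Variety.Alg.{u, u} V :=
  ofSub (ultrafilters D X)

/-- The inclusion `i : TX → X**`. -/
def ultrafilterIncl (D X : Variety.Alg.{u, u} V) :
    ultrafilterObj D X ⟶ (doubleDualFunctor D).obj X :=
  subIncl (ultrafilters D X)

theorem ultrafilterIncl_injective (D X : Variety.Alg.{u, u} V) :
    Function.Injective (ultrafilterIncl D X) := fun _ _ h => Subtype.ext h

/-- Factorization of a homomorphism into `X**` through `TX`. -/
def ultrafilterLift (D : Variety.Alg.{u, u} V) {X Y : Variety.Alg.{u, u} V}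
    (f : Y ⟶ (doubleDualFunctor D).obj X) (hf : ∀ y, f y ∈ ultrafilters D X) :
    Y ⟶ ultrafilterObj D X :=
  mkHom (B := ultrafilterObj D X) (fun y => (⟨f y, hf y⟩ : ultrafilters D X))
    (fun σ a => Subtype.ext (hom_op f σ a))

/-- The endofunctor `T`, the subfunctor of `(-)**` given by the `D`-ultrafilters. -/
def ultrafilterFunctor (D : Variety.Alg.{u, u} V) :
    Variety.Alg.{u, u} V ⥤ Variety.Alg.{u, u} V where
  obj X := ultrafilterObj D X
  map {X Y} f := ultrafilterLift D (ultrafilterIncl D X ≫ (doubleDualFunctor D).map f) (by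
    intro x
    rw [mem_ultrafilters]
    intro A hA a
    exact mem_ultrafilters.1 x.2 A hA (f ≫ a))
  map_id _ := rfl
  map_comp _ _ := rfl

/-- For a cogenerator `D`, the unit of double dualization is injective. -/
theorem evalUnit_injective {D : Variety.Alg.{u, u} V} (hD : IsCoseparator D)
    (A : Variety.Alg.{u, u} V) : Function.Injective (evalUnit D A) := by
  intro x y hxy
  let S : V.sig.Substructure (pi fun _ : ULift.{u} Bool => A) :=
    { carrier := {p | ∀ f : A ⟶ D, f (p ⟨true⟩) = f (p ⟨false⟩)}
      fun_mem := fun {n} σ p hp f => by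
        have h1 := hom_op f σ (fun i => p i ⟨true⟩)
        have h2 := hom_op f σ (fun i => p i ⟨false⟩)
        have h3 : (fun i => f (p i ⟨true⟩)) = fun i => f (p i ⟨false⟩) :=
          funext fun i => hp i f
        exact h1.trans ((congrArg (oper D σ) h3).trans h2.symm) }
  let p (b : Bool) : ofSub S ⟶ A :=
    subIncl S ≫ (proj (fun _ : ULift.{u} Bool => A) ⟨b⟩ : (pi fun _ : ULift.{u} Bool => A) ⟶ A)
  have hp : p true = p false := hD.def _ _ fun f => hom_ext fun q => q.2 f
  have hmem : (fun b => if b.down then x else y : ULift.{u} Bool → A) ∈ S := fun f =>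
    congrArg (fun g : (doubleDualFunctor D).obj A => toHom (A := ihom A D) (B := D) g (ofHom f)) hxy
  exact congrArg (fun g : ofSub S ⟶ A => g ⟨_, hmem⟩) hp

/-- The unit of double dualization takes its values in the `D`-ultrafilters. -/
theorem evalUnit_mem (D X : Variety.Alg.{u, u} V) (x : X) :
    evalUnit D X x ∈ ultrafilters D X :=
  mem_ultrafilters.2 fun _ _ a => ⟨a x, rfl⟩

/-- For a cogenerator `D`, the multiplication of double dualization restricts to the
`D`-ultrafilters. -/
theorem mul_mem {D : Variety.Alg.{u, u} V} (hD : IsCoseparator D) (X : Variety.Alg.{u, u} V)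
    (x : ultrafilterObj D (ultrafilterObj D X)) :
    evalMul D X ((doubleDualFunctor D).map (ultrafilterIncl D X)
      (ultrafilterIncl D (ultrafilterObj D X) x)) ∈ ultrafilters D X := by
  refine mem_ultrafilters.2 fun A hA a => ?_
  choose q hq using fun y : ultrafilterObj D X => mem_ultrafilters.1 y.2 A hA a
  have hinj := evalUnit_injective hD A
  let ψ : ultrafilterObj D X ⟶ A := mkHom q (fun σ y => hinj (by
    rw [hq, hom_op]
    have h1 := hom_op (ultrafilterIncl D X ≫ (doubleDualFunctor D).map a) σ y
    exact h1.trans (congrArg (oper _ σ) (funext fun i => (hq (y i)).symm))))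
  have hψ : ψ ≫ evalUnit D A = ultrafilterIncl D X ≫ (doubleDualFunctor D).map a :=
    hom_ext hq
  obtain ⟨t, ht⟩ := mem_ultrafilters.1 x.2 A hA ψ
  refine ⟨t, ht.trans ?_⟩
  have h2 := congrArg (fun k => evalMul D A ((doubleDualFunctor D).map k x.1)) hψ
  exact h2

/-- The `D`-ultrafilter monad: the endofunctor `T` of all `D`-ultrafilters, with unit and
multiplication restricted from `(-)**`. -/
def ultrafilterMonad (D : Variety.Alg.{u, u} V) (hD : IsCoseparator D) :
    Monad (Variety.Alg.{u, u} V) where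
  toFunctor := ultrafilterFunctor D
  η := { app := fun X => ultrafilterLift D (evalUnit D X) (evalUnit_mem D X)
         naturality := fun _ _ _ => rfl }
  μ := { app := fun X => ultrafilterLift D
          (ultrafilterIncl D (ultrafilterObj D X) ≫
            (doubleDualFunctor D).map (ultrafilterIncl D X) ≫ evalMul D X)
          (mul_mem hD X)
         naturality := fun _ _ _ => rfl }
  assoc _ := rfl
  left_unit _ := rfl
  right_unit _ := rfl

/-- The `D`-ultrafilter monad is a submonad of `(-)**`. -/
def ultrafilterMonadIncl (D : Variety.Alg.{u, u} V) (hD : IsCoseparator D) :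
    ultrafilterMonad D hD ⟶ doubleDual D where
  app X := ultrafilterIncl D X
  naturality _ _ _ := rfl
  app_η _ := rfl
  app_μ _ := rfl

/-! ### Enriched natural transformations and enriched codensity monads -/

section Enriched

variable (P : ObjectProperty (Variety.Alg.{u, u} V))

/-- The product of the algebras `[[X, A], [Z, A]]` over all `A` in the full subcategory `P`. (The
index set is a class, so the carrier lies in the next universe.) -/
def familyAlg (X Z : Variety.Alg.{u, u} V) : Variety.Alg.{u, u + 1} V :=
  pi fun A : P.FullSubcategory => ihom (ihom X A.obj) (ihom Z A.obj)

/-- The projections of the product `familyAlg`. -/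
def familyProj (X Z : Variety.Alg.{u, u} V) (A : P.FullSubcategory) :
    familyAlg P X Z →[V.sig] ihom (ihom X A.obj) (ihom Z A.obj) :=
  proj (fun A : P.FullSubcategory => ihom (ihom X A.obj) (ihom Z A.obj)) A

/-- The composite of `p_B ⊗ [Z, E-]` with the composition map
`[[X, B], [Z, B]] ⊗ [[Z, B], [Z, C]] → [[X, B], [Z, C]]`. -/
def uHat (X Z : Variety.Alg.{u, u} V) (B C : P.FullSubcategory) :
    Bimorphism (familyAlg P X Z) (ihom B.obj C.obj) (ihom (ihom X B.obj) (ihom Z C.obj)) :=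
  (comp (ihom X B.obj) (ihom Z B.obj) (ihom Z C.obj)).precomp
    (familyProj P X Z B) (homAct Z B.obj C.obj)

/-- The composite of the symmetry, of `[X, E-] ⊗ p_C` and of the composition map
`[[X, B], [X, C]] ⊗ [[X, C], [Z, C]] → [[X, B], [Z, C]]`. -/
def vHat (X Z : Variety.Alg.{u, u} V) (B C : P.FullSubcategory) :
    Bimorphism (familyAlg P X Z) (ihom B.obj C.obj) (ihom (ihom X B.obj) (ihom Z C.obj)) :=
  ((comp (ihom X B.obj) (ihom X C.obj) (ihom Z C.obj)).flip).precomp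
    (familyProj P X Z C) (homAct X B.obj C.obj)

/-- The joint equalizer of the transposes of `uHat B C` and `vHat B C`: the object `N(X, Z)` of enriched
natural transformations `[X, E-] → [Z, E-]`, where `E` is the embedding of the full subcategory
`P`. -/
def natSub (X Z : Variety.Alg.{u, u} V) : V.sig.Substructure (familyAlg P X Z) :=
  ⨅ (B : P.FullSubcategory) (C : P.FullSubcategory),
    FirstOrder.Language.Hom.eqLocus (uHat P X Z B C).curry (vHat P X Z B C).curry

/-- The algebra `N(X, Z)` of enriched natural transformations from `[X, E-]` to `[Z, E-]`. -/
def enrichedNat (X Z : Variety.Alg.{u, u} V) : Variety.Alg.{u, u + 1} V :=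
  ofSub (natSub P X Z)

/-- The component `[X, A] → [Z, A]` of an enriched natural transformation. -/
def natComponent {P : ObjectProperty (Variety.Alg.{u, u} V)}
    {X Z : Variety.Alg.{u, u} V} (τ : enrichedNat P X Z) (A : P.FullSubcategory) :
    ihom X A.obj ⟶ ihom Z A.obj :=
  toHom (familyProj P X Z A τ.1)

theorem mem_natSub {X Z : Variety.Alg.{u, u} V} {τ : familyAlg P X Z} :
    τ ∈ natSub P X Z ↔ ∀ (B C : P.FullSubcategory) (f : B.obj ⟶ C.obj),
      toHom (familyProj P X Z B τ) ≫ toHom (homAct Z B.obj C.obj (ofHom f)) =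
        toHom (homAct X B.obj C.obj (ofHom f)) ≫ toHom (familyProj P X Z C τ) := by
  unfold natSub
  simp only [FirstOrder.Language.Substructure.mem_iInf]
  constructor
  · intro h B C f
    exact congrArg (fun k => toHom (toHom k (ofHom f))) (h B C)
  · intro h B C
    exact hom_ext (A := ihom B.obj C.obj) (B := ihom (ihom X B.obj) (ihom Z C.obj))
      (fun f => h B C f)

/-- The contravariant action `N(X, h)` of `N(X, -)` on a homomorphism `h : Z' ⟶ Z`: the components
are composed with `[h, A]`. -/
def natMapRight {P : ObjectProperty (Variety.Alg.{u, u} V)}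
    {X Z Z' : Variety.Alg.{u, u} V} (h : Z' ⟶ Z) (τ : enrichedNat P X Z) :
    enrichedNat P X Z' :=
  (⟨fun A => natComponent τ A ≫ precompHom h A.obj, (mem_natSub P).2 fun B C f =>
    congrArg (fun k : ihom X B.obj ⟶ ihom Z C.obj => k ≫ precompHom h C.obj)
      ((mem_natSub P).1 τ.2 B C f)⟩ : natSub P X Z')

/-- The covariant action of `N(-, Z)` on a homomorphism `g : X ⟶ Y`: the components are
precomposed with `[g, A]`. -/
def natMapLeft {P : ObjectProperty (Variety.Alg.{u, u} V)}
    {X Y Z : Variety.Alg.{u, u} V} (g : X ⟶ Y) (τ : enrichedNat P X Z) :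
    enrichedNat P Y Z :=
  (⟨fun A => precompHom g A.obj ≫ natComponent τ A, (mem_natSub P).2 fun B C f =>
    congrArg (fun k : ihom X B.obj ⟶ ihom Z C.obj => precompHom g B.obj ≫ k)
      ((mem_natSub P).1 τ.2 B C f)⟩ : natSub P Y Z)

/-- The data exhibiting a monad `T` as the enriched codensity monad of the embedding `E` of the full
subcategory `P`, i.e. as the enriched right Kan extension of `E` along itself with its canonical
monad structure. -/
structure EnrichedCodensity (T : Monad (Variety.Alg.{u, u} V)) where
  /-- `T` is an enriched functor: its action on hom-objects is a homomorphism. -/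
  map_op : ∀ (X Y : Variety.Alg.{u, u} V) {n : ℕ} (σ : V.sig.Functions n)
    (f : Fin n → ihom X Y),
    ofHom (T.map (toHom (oper (ihom X Y) σ f))) =
      oper (ihom (T.obj X) (T.obj Y)) σ (fun i => ofHom (T.map (toHom (f i))))
  /-- the isomorphisms `[Z, TX] ≅ N(X, Z)` of algebras -/
  iso : ∀ X Z : Variety.Alg.{u, u} V, ihom Z (T.obj X) ≃[V.sig] enrichedNat P X Z
  /-- naturality in `Z` (as elements of hom-objects are homomorphisms and homomorphisms out of
  hom-objects are determined by their values, this equation is also the enriched naturality) -/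
  naturalRight : ∀ {X Z Z' : Variety.Alg.{u, u} V} (h : Z' ⟶ Z) (z : Z ⟶ T.obj X),
    iso X Z' (ofHom (h ≫ z)) = natMapRight h (iso X Z (ofHom z))
  /-- naturality in `X` -/
  naturalLeft : ∀ {X Y Z : Variety.Alg.{u, u} V} (g : X ⟶ Y) (z : Z ⟶ T.obj X),
    iso Y Z (ofHom (z ≫ T.map g)) = natMapLeft g (iso X Z (ofHom z))
  /-- the unit of `T` corresponds to the identity transformation of `[X, E-]`, that is,
  `ψ a ∘ η = a`, where `ψ a : TX ⟶ A` is the value at `a : X ⟶ A` of the transformation that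
  corresponds to the identity of `TX` -/
  unit : ∀ (X : Variety.Alg.{u, u} V) (A : P.FullSubcategory) (a : X ⟶ A.obj),
    natComponent (iso X X (ofHom (T.η.app X))) A (ofHom a) = ofHom a
  /-- the multiplication of `T` is the one of the codensity monad: `ψ a ∘ μ = ψ (ψ a)` -/
  mul : ∀ (X : Variety.Alg.{u, u} V) (A : P.FullSubcategory) (a : X ⟶ A.obj),
    natComponent (iso X (T.obj (T.obj X)) (ofHom (T.μ.app X))) A (ofHom a) =
      natComponent (iso (T.obj X) (T.obj (T.obj X)) (ofHom (𝟙 (T.obj (T.obj X))))) A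
        (natComponent (iso X (T.obj X) (ofHom (𝟙 (T.obj X)))) A (ofHom a))

/-- `T` is the enriched codensity monad of the embedding of the full subcategory `P`. -/
def IsEnrichedCodensityMonad (T : Monad (Variety.Alg.{u, u} V)) : Prop :=
  Nonempty (EnrichedCodensity P T)

end Enriched

end EntropicVariety

end

open EntropicVariety

/-!
Dualization is adjoint to itself on the right, so it turns colimits into limits; since `X*` is the
colimit of the `A*`, the algebra `X**` is the limit of the `A**` over all `a : X ⟶ A` with `A`
finitely presentable. The units `A ⟶ A**` are injective and natural, hence the ultrafilters on `X`,
the elements of `X**` which land in `A` for every `a`, form the limit of the algebras `A`. A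
transformation `[X, E-] ⟶ [Z, E-]` is in particular a cone over the same diagram with vertex `Z`,
so it corresponds to a homomorphism `Z ⟶ TX`.
-/

noncomputable section

namespace EntropicVariety

section Injective

variable {V : Variety.{u}} {A B Y : Variety.Alg.{u, v} V}

theorem mono_of_injective {i : A ⟶ B} (hi : Function.Injective i) : Mono i :=
  ⟨fun _ _ h => hom_ext fun y => hi (DFunLike.congr_fun h y)⟩

/-- The factorization of `f` through an injective homomorphism `i` whose image contains that of
`f`. -/
def liftOfInjective (i : A ⟶ B) (hi : Function.Injective i) (f : Y ⟶ B)
    (hf : ∀ y, ∃ a, i a = f y) : Y ⟶ A :=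
  mkHom (fun y => (hf y).choose) fun σ y => hi <| by
    rw [(hf _).choose_spec, hom_op, hom_op]
    exact congrArg (oper B σ) (funext fun k => (hf (y k)).choose_spec.symm)

theorem liftOfInjective_comp (i : A ⟶ B) (hi : Function.Injective i) (f : Y ⟶ B)
    (hf : ∀ y, ∃ a, i a = f y) : liftOfInjective i hi f hf ≫ i = f :=
  hom_ext fun y => (hf y).choose_spec

end Injective

variable {V : Variety.{u}} [V.IsCommutative]

section PointwiseOperations

variable {A B C : Variety.Alg.{u, u} V} {n : ℕ} (σ : V.sig.Functions n)

/-- The operation `σ` of the hom-object `[A, B]`, applied to homomorphisms. -/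
def homOper (f : Fin n → (A ⟶ B)) : A ⟶ B :=
  toHom (oper (ihom A B) σ fun i => ofHom (f i))

theorem comp_homOper (g : A ⟶ B) (f : Fin n → (B ⟶ C)) :
    g ≫ homOper σ f = homOper σ fun i => g ≫ f i :=
  (comp A B C).map_right σ (ofHom g) fun i => ofHom (f i)

theorem homOper_comp (f : Fin n → (A ⟶ B)) (g : B ⟶ C) :
    homOper σ f ≫ g = homOper σ fun i => f i ≫ g :=
  (comp A B C).map_left σ (fun i => ofHom (f i)) (ofHom g)

theorem precompHom_homOper (f : Fin n → (A ⟶ B)) (C : Variety.Alg.{u, u} V) :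
    precompHom (homOper σ f) C = homOper σ fun i => precompHom (f i) C :=
  (comp A B C).curry.map_fun σ fun i => ofHom (f i)

theorem doubleDualFunctor_map_homOper (D : Variety.Alg.{u, u} V) (f : Fin n → (A ⟶ B)) :
    (doubleDualFunctor D).map (homOper σ f) =
      homOper σ fun i => (doubleDualFunctor D).map (f i) :=
  (congrArg (precompHom · D) (precompHom_homOper σ f D)).trans (precompHom_homOper σ _ D)

end PointwiseOperations

section DoubleDual

variable (D : Variety.Alg.{u, u} V)

/-- The dualization functor is adjoint to itself on the right; unit and counit are the evaluation
homomorphisms. -/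
def dualAdjunction : (dual D).rightOp ⊣ dual D where
  unit := (doubleDual D).η
  counit := { app := fun X => (evalUnit D X.unop).op
              naturality := fun _ _ _ => rfl }
  left_triangle_components _ := rfl
  right_triangle_components _ := rfl

variable {D} {J : Type w} [Category.{w'} J] {F : J ⥤ Variety.Alg.{u, u} V}

/-- The dual of the colimit cocone `c*` is a limit cone, and it is `c**` up to the equivalence of
`J` with `Jᵒᵖᵒᵖ`. -/
def isLimitDoubleDualMapCone {c : Cone F} (hc : IsColimit ((dual D).mapCocone c.op)) :
    IsLimit ((doubleDualFunctor D).mapCone c) :=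
  have := (dualAdjunction D).rightAdjoint_preservesLimits
  (isLimitOfPreserves (dual D) hc.op).whiskerEquivalence (opOpEquivalence J).symm

end DoubleDual

section EnrichedNat

variable {P : ObjectProperty (Variety.Alg.{u, u} V)} {X Z : Variety.Alg.{u, u} V}

theorem enrichedNat_ext {τ τ' : enrichedNat P X Z}
    (h : ∀ (A : P.FullSubcategory) (a : X ⟶ A.obj),
      natComponent τ A (ofHom a) = natComponent τ' A (ofHom a)) : τ = τ' :=
  Subtype.ext (funext fun A => hom_ext (A := ihom X A.obj) (B := ihom Z A.obj) (h A))

theorem natComponent_comp (τ : enrichedNat P X Z) {A B : P.FullSubcategory} (a : X ⟶ A.obj)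
    (f : A ⟶ B) :
    toHom (natComponent τ B (ofHom (a ≫ P.ι.map f))) =
      toHom (natComponent τ A (ofHom a)) ≫ P.ι.map f :=
  congrArg (fun k : ihom X A.obj ⟶ ihom Z B.obj => toHom (k (ofHom a)))
    ((mem_natSub P).1 τ.2 A B (P.ι.map f)).symm

variable (P X) in
/-- The diagram of the algebras in `P` under `X`, over which the pointwise right Kan extension of
the embedding of `P` along itself is the limit at `X`. -/
abbrev underDiagram : StructuredArrow X P.ι ⥤ Variety.Alg.{u, u} V :=
  StructuredArrow.proj X P.ι ⋙ P.ι

variable (P X) in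
/-- The tautological cone with vertex `X` and legs `a : X ⟶ A`. -/
def underCone : Cone (underDiagram P X) where
  pt := X
  π := { app := fun a => a.hom
         naturality := fun _ _ f => (Category.id_comp _).trans (StructuredArrow.w f).symm }

/-- The cone with vertex `Z` whose legs are the values of a transformation
`[X, E-] ⟶ [Z, E-]`. -/
def natCone (τ : enrichedNat P X Z) : Cone (underDiagram P X) where
  pt := Z
  π :=
    { app := fun a => toHom (natComponent τ a.right (ofHom a.hom))
      naturality := fun a b f => by
        have h := natComponent_comp τ a.hom f.right
        rw [StructuredArrow.w f] at h
        exact (Category.id_comp _).trans h }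

variable {L : Variety.Alg.{u, u} V} {τ : enrichedNat P X L}

/-- A transformation `τ : [X, E-] ⟶ [L, E-]` whose cone is a limit yields `[Z, L] ≅ N(X, Z)`: a
homomorphism `z` corresponds to `[z, E-] ∘ τ`, and a transformation to the homomorphism induced by
its cone. -/
def enrichedNatEquivOfIsLimit (hτ : IsLimit (natCone τ)) (Z : Variety.Alg.{u, u} V) :
    ihom Z L ≃[V.sig] enrichedNat P X Z where
  toFun z := natMapRight (toHom z) τ
  invFun ρ := ofHom (hτ.lift (natCone ρ))
  left_inv z := (hτ.uniq (natCone (natMapRight (toHom z) τ)) (toHom z) fun _ => rfl).symm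
  right_inv ρ := enrichedNat_ext fun _ a => hτ.fac (natCone ρ) (StructuredArrow.mk a)
  map_fun' σ z := enrichedNat_ext fun A a =>
    homOper_comp σ (fun i => toHom (z i)) (toHom (natComponent τ A (ofHom a)))
  map_rel' r := isEmptyElim r

end EnrichedNat

section UltrafilterLim

variable {D : Variety.Alg.{u, u} V} (hD : IsCoseparator D) {X Y : Variety.Alg.{u, u} V}
  {A B : (fp V).FullSubcategory}

include hD in
theorem mono_evalUnit (A : Variety.Alg.{u, u} V) : Mono (evalUnit D A) :=
  mono_of_injective (evalUnit_injective hD A)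

/-- The homomorphism `ψ a : TX ⟶ A` through which `a** : X** ⟶ A**` factorizes on the
`D`-ultrafilters. For sets and `D = 2`, it sends an ultrafilter to its limit along the map `a` into
the finite set `A`. -/
def ultrafilterLim (a : X ⟶ A.obj) : ultrafilterObj D X ⟶ A.obj :=
  liftOfInjective (evalUnit D A.obj) (evalUnit_injective hD A.obj)
    (ultrafilterIncl D X ≫ (doubleDualFunctor D).map a)
    fun x => mem_ultrafilters.1 x.2 A.obj A.property a

theorem ultrafilterLim_comp_evalUnit (a : X ⟶ A.obj) :
    ultrafilterLim hD a ≫ evalUnit D A.obj =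
      ultrafilterIncl D X ≫ (doubleDualFunctor D).map a :=
  liftOfInjective_comp ..

theorem comp_ultrafilterLim_eq_iff (f : Y ⟶ ultrafilterObj D X) (a : X ⟶ A.obj)
    (g : Y ⟶ A.obj) :
    f ≫ ultrafilterLim hD a = g ↔
      f ≫ ultrafilterIncl D X ≫ (doubleDualFunctor D).map a = g ≫ evalUnit D A.obj := by
  have := mono_evalUnit hD A.obj
  rw [← ultrafilterLim_comp_evalUnit hD, ← Category.assoc, cancel_mono]

theorem ultrafilterLim_eq_iff (a : X ⟶ A.obj) (g : ultrafilterObj D X ⟶ A.obj) :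
    ultrafilterLim hD a = g ↔
      ultrafilterIncl D X ≫ (doubleDualFunctor D).map a = g ≫ evalUnit D A.obj :=
  comp_ultrafilterLim_eq_iff hD (𝟙 _) a g

theorem ultrafilterLim_comp (a : X ⟶ A.obj) (f : A.obj ⟶ B.obj) :
    ultrafilterLim hD (A := B) (a ≫ f) = ultrafilterLim hD a ≫ f := by
  rw [ultrafilterLim_eq_iff]
  calc ultrafilterIncl D X ≫ (doubleDualFunctor D).map (a ≫ f)
    _ = (ultrafilterIncl D X ≫ (doubleDualFunctor D).map a) ≫ (doubleDualFunctor D).map f := by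
      rw [Functor.map_comp, Category.assoc]
    _ = (ultrafilterLim hD a ≫ evalUnit D A.obj) ≫ (doubleDualFunctor D).map f := by
      rw [ultrafilterLim_comp_evalUnit]
    _ = (ultrafilterLim hD a ≫ f) ≫ evalUnit D B.obj :=
      congrArg (ultrafilterLim hD a ≫ ·) ((doubleDual D).η.naturality f).symm

theorem map_comp_ultrafilterLim (g : X ⟶ Y) (a : Y ⟶ A.obj) :
    (ultrafilterFunctor D).map g ≫ ultrafilterLim hD a = ultrafilterLim hD (g ≫ a) :=
  (comp_ultrafilterLim_eq_iff hD ((ultrafilterFunctor D).map g) a _).2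
    (ultrafilterLim_comp_evalUnit hD (g ≫ a)).symm

theorem unit_comp_ultrafilterLim (a : X ⟶ A.obj) :
    (ultrafilterMonad D hD).η.app X ≫ ultrafilterLim hD a = a :=
  (comp_ultrafilterLim_eq_iff hD ((ultrafilterMonad D hD).η.app X) a a).2 rfl

theorem mul_comp_ultrafilterLim (a : X ⟶ A.obj) :
    (ultrafilterMonad D hD).μ.app X ≫ ultrafilterLim hD a =
      ultrafilterLim hD (ultrafilterLim hD a) := by
  let μ : ultrafilterObj D (ultrafilterObj D X) ⟶ ultrafilterObj D X :=
    (ultrafilterMonad D hD).μ.app X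
  refine (comp_ultrafilterLim_eq_iff hD μ a _).2 ?_
  calc μ ≫ ultrafilterIncl D X ≫ (doubleDualFunctor D).map a
    _ = ultrafilterIncl D (ultrafilterObj D X) ≫
          (doubleDualFunctor D).map (ultrafilterIncl D X) ≫
            evalMul D X ≫ (doubleDualFunctor D).map a := rfl
    _ = ultrafilterIncl D (ultrafilterObj D X) ≫
          (doubleDualFunctor D).map (ultrafilterIncl D X ≫ (doubleDualFunctor D).map a) ≫
            evalMul D A.obj :=
      congrArg (ultrafilterIncl D (ultrafilterObj D X) ≫
        (doubleDualFunctor D).map (ultrafilterIncl D X) ≫ ·) ((doubleDual D).μ.naturality a).symm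
    _ = ultrafilterIncl D (ultrafilterObj D X) ≫
          (doubleDualFunctor D).map (ultrafilterLim hD a ≫ evalUnit D A.obj) ≫
            evalMul D A.obj := by rw [ultrafilterLim_comp_evalUnit]
    _ = ultrafilterIncl D (ultrafilterObj D X) ≫
          (doubleDualFunctor D).map (ultrafilterLim hD a) :=
      congrArg (ultrafilterIncl D (ultrafilterObj D X) ≫
        (doubleDualFunctor D).map (ultrafilterLim hD a) ≫ ·) ((doubleDual D).right_unit A.obj)
    _ = ultrafilterLim hD (ultrafilterLim hD a) ≫ evalUnit D A.obj :=
      (ultrafilterLim_comp_evalUnit hD (ultrafilterLim hD a)).symm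

variable {n : ℕ} (σ : V.sig.Functions n)

theorem ultrafilterLim_homOper (a : Fin n → (X ⟶ A.obj)) :
    ultrafilterLim hD (homOper σ a) = homOper σ fun i => ultrafilterLim hD (a i) := by
  simp only [ultrafilterLim_eq_iff, doubleDualFunctor_map_homOper, comp_homOper, homOper_comp,
    ultrafilterLim_comp_evalUnit]

variable (D) in
theorem ultrafilterFunctor_map_homOper (f : Fin n → (X ⟶ Y)) :
    (ultrafilterFunctor D).map (homOper σ f) =
      homOper σ fun i => (ultrafilterFunctor D).map (f i) := by
  have := mono_of_injective (ultrafilterIncl_injective D Y)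
  refine (cancel_mono (ultrafilterIncl D Y)).1 ?_
  calc ultrafilterIncl D X ≫ (doubleDualFunctor D).map (homOper σ f)
    _ = homOper σ fun i => ultrafilterIncl D X ≫ (doubleDualFunctor D).map (f i) := by
      rw [doubleDualFunctor_map_homOper, comp_homOper]

variable (X) in
/-- The enriched natural transformation `[X, E-] ⟶ [TX, E-]` with `a ↦ ψ a`. -/
def ultrafilterNat : enrichedNat (fp V) X (ultrafilterObj D X) :=
  (⟨fun A => mkHom (A := ihom X A.obj) (B := ihom (ultrafilterObj D X) A.obj)
      (fun a => ofHom (ultrafilterLim hD (toHom a)))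
      (fun σ a => ultrafilterLim_homOper hD σ fun i => toHom (a i)),
    (mem_natSub (fp V)).2 fun _ _ f =>
      hom_ext fun a => (ultrafilterLim_comp hD (toHom a) f).symm⟩ : natSub (fp V) X _)

end UltrafilterLim

section Limit

variable {D : Variety.Alg.{u, u} V} {X Y : Variety.Alg.{u, u} V}

/-- The algebra `X**` is the limit of the `A**`, because the cocone of all `a*` is the image of the
cone of all `a` under dualization. -/
def isLimitDoubleDualMapUnderCone (hc : IsColimit (dualCocone D X)) :
    IsLimit ((doubleDualFunctor D).mapCone (underCone (fp V) X)) :=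
  isLimitDoubleDualMapCone hc

theorem ultrafilterLim_jointly_mono (hD : IsCoseparator D) (hc : IsColimit (dualCocone D X))
    {f g : Y ⟶ ultrafilterObj D X}
    (h : ∀ (A : (fp V).FullSubcategory) (a : X ⟶ A.obj),
      f ≫ ultrafilterLim hD a = g ≫ ultrafilterLim hD a) : f = g := by
  have := mono_of_injective (ultrafilterIncl_injective D X)
  refine (cancel_mono (ultrafilterIncl D X)).1
    ((isLimitDoubleDualMapUnderCone hc).hom_ext fun a => ?_)
  exact ((comp_ultrafilterLim_eq_iff hD f a.hom _).1 (h a.right a.hom)).trans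
    ((comp_ultrafilterLim_eq_iff hD g a.hom _).1 rfl).symm

/-- The homomorphism to `X**` induced by a cone over the finitely presentable algebras under `X`,
whose legs are composed with the units `A ⟶ A**`. -/
def liftDoubleDual (hc : IsColimit (dualCocone D X)) (s : Cone (underDiagram (fp V) X)) :
    s.pt ⟶ (doubleDualFunctor D).obj X :=
  (isLimitDoubleDualMapUnderCone hc).lift
    ((Cone.postcompose (Functor.whiskerLeft (underDiagram (fp V) X) (doubleDual D).η)).obj s)

theorem liftDoubleDual_comp_map (hc : IsColimit (dualCocone D X))
    (s : Cone (underDiagram (fp V) X)) (a : StructuredArrow X (fp V).ι) :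
    liftDoubleDual hc s ≫ (doubleDualFunctor D).map a.hom = s.π.app a ≫ evalUnit D a.right.obj :=
  (isLimitDoubleDualMapUnderCone hc).fac _ a

theorem liftDoubleDual_mem (hc : IsColimit (dualCocone D X)) (s : Cone (underDiagram (fp V) X))
    (y : s.pt) : liftDoubleDual hc s y ∈ ultrafilters D X :=
  mem_ultrafilters.2 fun A hA a =>
    let j := StructuredArrow.mk (Y := (⟨A, hA⟩ : (fp V).FullSubcategory)) a
    ⟨s.π.app j y, (DFunLike.congr_fun (liftDoubleDual_comp_map hc s j) y).symm⟩

/-- The algebra `TX` is the limit of the finitely presentable algebras under `X`. -/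
def isLimitNatConeUltrafilterNat (hD : IsCoseparator D) (hc : IsColimit (dualCocone D X)) :
    IsLimit (natCone (ultrafilterNat hD X)) :=
  let lift (s : Cone (underDiagram (fp V) X)) : s.pt ⟶ ultrafilterObj D X :=
    ultrafilterLift D (liftDoubleDual hc s) (liftDoubleDual_mem hc s)
  have fac (s : Cone (underDiagram (fp V) X)) (a : StructuredArrow X (fp V).ι) :
      lift s ≫ ultrafilterLim hD a.hom = s.π.app a :=
    (comp_ultrafilterLim_eq_iff hD (lift s) a.hom _).2 (liftDoubleDual_comp_map hc s a)
  { lift := lift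
    fac := fac
    uniq := fun s _ h => ultrafilterLim_jointly_mono hD hc fun _ a =>
      (h (StructuredArrow.mk a)).trans (fac s (StructuredArrow.mk a)).symm }

end Limit

end EntropicVariety

end

theorem theoremT (V : Variety.{u}) [V.IsCommutative] (D : Variety.Alg.{u, u} V)
    (hD : IsStarCogenerator D) :
    IsEnrichedCodensityMonad (fp V) (ultrafilterMonad D hD.isCogenerator) := by
  have isLimit (X : Variety.Alg.{u, u} V) :
      IsLimit (natCone (ultrafilterNat hD.isCogenerator X)) :=
    isLimitNatConeUltrafilterNat hD.isCogenerator (hD.isStarObject X).some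
  exact
    ⟨{  map_op := fun X Y _ σ f => ultrafilterFunctor_map_homOper D σ fun i => toHom (f i)
        iso := fun X => enrichedNatEquivOfIsLimit (isLimit X)
        naturalRight := fun _ _ => rfl
        naturalLeft := fun g z => enrichedNat_ext fun _ a =>
          congrArg (z ≫ ·) (map_comp_ultrafilterLim hD.isCogenerator g a)
        unit := fun _ _ a => unit_comp_ultrafilterLim hD.isCogenerator a
        mul := fun _ _ a => mul_comp_ultrafilterLim hD.isCogenerator a }⟩
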